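/- Let $K$ be a finite field, $s\ge 2$, and let $A_1,\dots,A_s\subseteq K$ be subsets with $d_i=|A_i|$ such that (i) $\{0,1\}\subseteq A_i$ for all $i$; (ii) $a/b\in A_j$ whenever $1\le i<j\le s$, $a\in A_j$, $0\neq b\in A_i$; (iii) $d_1\le\cdots\le d_s$. Let $\mathcal X\subseteq\mathbb P^{s-1}(K)$ be the set of all points $[v]$ with $0\neq v\in A_1\times\cdots\times A_s$ (a projective nested cartesian set), let $S=K[t_1,\dots,t_s]$ with the standard grading, and let $I(\mathcal X)\subseteq S$ be the ideal generated by the homogeneous polynomials that vanish at all points of $\mathcal X$. Let $\prec$ be the lexicographical order on the monomials of $S$ with $t_1\prec\cdots\prec t_s$; that is, $t^a\prec t^b$ if and only if $a_i<b_i$ at the largest index $i$ with $a_i\ne b_i$. For $g\neq0$ let $\mathrm{in}(g)$ be the $\prec$-largest monomial occurring in $g$, and let $\mathrm{in}(I)$ be the ideal generated by the monomials $\mathrm{in}(g)$ with $0\neq g\in I$. For a graded ideal $J\subsetneq S$ with $k=\dim S/J$ (Krull dimension), put $\deg S/J=(k-1)!\,\lim_{n\to\infty}\dim_K(S_n/J_n)/n^{k-1}$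 if $k\ge1$, where $S_n$ is the space of homogeneous polynomials of degree $n$ and $J_n=J\cap S_n$, and $\deg S/J=\dim_K S/J$ if $k=0$. Let $f\ne0$ be a standard polynomial of $S/I(\mathcal X)$, i.e. no monomial occurring in $f$ is the initial monomial of a nonzero element of $I(\mathcal X)$, and suppose that $\mathrm{in}(f)=t_r^{a_r}\cdots t_s^{a_s}$ with $1\le r\le s$ and $a_r\ge1$; put $a_i=0$ for $i<r$. Then $0\le a_i\le d_i-1$ for all $i>r$, the degrees below exist and are nonnegative integers, and $$\deg S/(\mathrm{in}(I(\mathcal X)),\mathrm{in}(f))=\begin{cases}\displaystyle\deg S/I(\mathcal X)-\sum_{i=2}^{r+1}\ \prod_{j=i}^{s}(d_j-a_j)&\text{if }a_r\le d_r,\\[2ex]\displaystyle\deg S/I(\mathcal X)-\prod_{j=r+1}^{s}(d_j-a_j)&\text{if }a_r\ge d_r+1,\end{cases}$$ where empty products are $1$. If moreover $f$ is homogeneous, then the set $V_{\mathcal X}(f)$ of zeros of $f$ in $\mathcal X$ satisfies $$|V_{\mathcal X}(f)|\le\deg S/(\mathrm{in}(I(\mathcal X)),\mathrm{in}(f)).$$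 -/

import Mathlib

open MvPolynomial

noncomputable section

namespace NestedCartesian

/-- The lexicographical order on the monomials of `K[t_1, …, t_s]` with `t_1 ≺ ⋯ ≺ t_s`.
The variables are indexed by `Fin s`, so that `t_i` is `X (i - 1)`; Mathlib's lexicographic order
makes the variable of smallest index the largest, hence the order dual. -/
def lexOrder (s : ℕ) : MonomialOrder (Fin s) where
  syn := Lex ((Fin s)ᵒᵈ →₀ ℕ)
  toSyn := (Finsupp.domCongr OrderDual.toDual).trans
    { toEquiv := toLex, map_add' := toLex_add }
  toSyn_monotone := fun _ _ h => Finsupp.toLex_monotone (fun i => h (OrderDual.ofDual i))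

/-- `t^a ≺ t^b` if and only if `a_i < b_i` at the largest index `i` where `a` and `b` differ. -/
theorem lexOrder_lt_iff {s : ℕ} (a b : Fin s →₀ ℕ) :
    (lexOrder s).toSyn a < (lexOrder s).toSyn b ↔
      ∃ i, (∀ j, i < j → a j = b j) ∧ a i < b i := Iff.rfl

variable {K : Type*} [Field K] {s : ℕ}

/-! ### Initial ideals and standard polynomials -/

/-- The initial ideal `in(I)`, generated by the initial monomials of the nonzero elements
of `I`. -/
def initialIdeal (m : MonomialOrder (Fin s)) (I : Ideal (MvPolynomial (Fin s) K)) :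
    Ideal (MvPolynomial (Fin s) K) :=
  Ideal.span {h | ∃ g ∈ I, g ≠ 0 ∧ h = monomial (m.degree g) 1}

/-- `t^e` is a standard monomial of `S/I`: it is not the initial monomial of any nonzero
polynomial of `I`. -/
def IsStandardMonomial (m : MonomialOrder (Fin s)) (I : Ideal (MvPolynomial (Fin s) K))
    (e : Fin s →₀ ℕ) : Prop :=
  ∀ g ∈ I, g ≠ 0 → m.degree g ≠ e

/-- A standard polynomial of `S/I`: a nonzero `K`-linear combination of standard monomials. -/
def IsStandardPolynomial (m : MonomialOrder (Fin s)) (I : Ideal (MvPolynomial (Fin s) K))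
    (f : MvPolynomial (Fin s) K) : Prop :=
  f ≠ 0 ∧ ∀ e ∈ f.support, IsStandardMonomial m I e

/-! ### Hilbert function and degree -/

/-- The Hilbert function `H_I(n) = dim_K (S_n / I_n)`, where `I_n = I ∩ S_n`. -/
def hilbertFunction (I : Ideal (MvPolynomial (Fin s) K)) (n : ℕ) : ℕ :=
  Module.finrank K (homogeneousSubmodule (Fin s) K n ⧸
    (I.restrictScalars K).submoduleOf (homogeneousSubmodule (Fin s) K n))

/-- `D` is the degree (multiplicity) of `S/I`. With `k` the Krull dimension of `S/I`, this is
`(k - 1)! lim_{n → ∞} H_I(n) / n^(k - 1)` (the limit is required to exist) if `k ≥ 1`, and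
`dim_K (S/I)` if `k = 0`. It is used for graded ideals `I ≠ S`. -/
def HasDegree (I : Ideal (MvPolynomial (Fin s) K)) (D : ℕ) : Prop :=
  (∃ k : ℕ, 1 ≤ k ∧ ringKrullDim (MvPolynomial (Fin s) K ⧸ I) = (k : WithBot ℕ∞) ∧
    Filter.Tendsto
      (fun n : ℕ => ((k - 1).factorial : ℝ) * ((hilbertFunction I n : ℝ) / (n : ℝ) ^ (k - 1)))
      Filter.atTop (nhds (D : ℝ))) ∨
  (ringKrullDim (MvPolynomial (Fin s) K ⧸ I) = 0 ∧
    Module.finrank K (MvPolynomial (Fin s) K ⧸ I) = D)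

/-! ### Subsets of projective space -/

/-- `f` vanishes at the point `p`, i.e. at every representative of `p`. For homogeneous `f`
this does not depend on the representative. -/
def VanishesAt (f : MvPolynomial (Fin s) K) (p : Projectivization K (Fin s → K)) : Prop :=
  ∀ (v : Fin s → K) (hv : v ≠ 0), Projectivization.mk K v hv = p → eval v f = 0

/-- The vanishing ideal of `X`, generated by the homogeneous polynomials that vanish at all
points of `X`. -/
def vanishingIdeal (X : Set (Projectivization K (Fin s → K))) : Ideal (MvPolynomial (Fin s) K) :=
  Ideal.span {g | (∃ n, g.IsHomogeneous n) ∧ ∀ p ∈ X, VanishesAt g p}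

/-- The set of zeros in `X` of a homogeneous polynomial `f`. -/
def zeroSet (X : Set (Projectivization K (Fin s → K))) (f : MvPolynomial (Fin s) K) :
    Set (Projectivization K (Fin s → K)) :=
  {p ∈ X | VanishesAt f p}

/-- The image `[A_1 × ⋯ × A_s]` of `A_1 × ⋯ × A_s \ {0}` in the projective space. -/
def cartesianSet (A : Fin s → Finset K) : Set (Projectivization K (Fin s → K)) :=
  {p | ∃ (v : Fin s → K) (hv : v ≠ 0), (∀ i, v i ∈ A i) ∧ p = Projectivization.mk K v hv}

/-- The conditions on `A_1, …, A_s` under which `[A_1 × ⋯ × A_s]` is a projective nested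
cartesian set. -/
structure IsNested (A : Fin s → Finset K) : Prop where
  zero_mem : ∀ i, (0 : K) ∈ A i
  one_mem : ∀ i, (1 : K) ∈ A i
  div_mem : ∀ i j, i < j → ∀ a ∈ A j, ∀ b ∈ A i, b ≠ 0 → a / b ∈ A j
  card_mono : ∀ i j, i ≤ j → (A i).card ≤ (A j).card

end NestedCartesian

end

open MvPolynomial

noncomputable section

namespace NestedCartesian

variable {K : Type*} [Field K] {s : ℕ}

/-! For `i < j` the form `t_i ∏_{c ∈ A_j} (t_j - c t_i)` vanishes on the nested cartesian set,
because a point with `v_i ≠ 0` has `v_j / v_i ∈ A_j`; its initial monomial is `t_i t_j^{d_j}`.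
Conversely, a polynomial of the vanishing ideal none of whose monomials is divisible by any of these
is zero (`eq_zero_of_isReduced_of_eval_eq_zero`). Hence these forms are a Gröbner basis, and the
standard monomials are the reduced ones (`isReduced_iff_isStandardMonomial`).

Both quotients have Krull dimension one, so each degree is the eventual value of a Hilbert function:
a number of reduced monomials of large degree `n`. Sort these by their lowest variable `t_i`. The
exponents at `j > i` are free below `d_j`, and the exponent of `t_i` is then forced by the degree,
which gives `∏_{j>i} d_j` monomials. The multiples of `t^a` among them number `∏_{j>i} (d_j - a_j)`
for `i ≤ r` and none for `i > r`. With truncated subtraction this count covers both cases: if `a_r >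
d_r`, the factor at `r` kills every term with `i < r`.

For the bound on zeros, the standard monomials of large degree for the basis together with `f` span
enough forms to interpolate arbitrary values on the zero set (`card_le_ncard_footprint`). -/

/-! ### Restriction to a line through the origin -/

/-- The restriction of polynomials to the line `K v`, with coordinate `T`: it maps `t_i`
to `v_i T`. -/
def lineMap (v : Fin s → K) : MvPolynomial (Fin s) K →ₐ[K] Polynomial K :=
  aeval fun i => Polynomial.C (v i) * Polynomial.X

/-- The kernel of `lineMap v` is thus the homogeneous ideal of the point `[v]`, so membership of an
inhomogeneous polynomial can be tested on its components. -/
theorem coeff_lineMap (v : Fin s → K) (g : MvPolynomial (Fin s) K) (n : ℕ) :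
    (lineMap v g).coeff n = eval v (homogeneousComponent n g) := by
  induction g using MvPolynomial.induction_on' with
  | monomial e c =>
    have h1 : lineMap v (monomial e c) =
        Polynomial.monomial e.degree (c * ∏ i, v i ^ e i) := by
      rw [lineMap, aeval_monomial, Finsupp.prod_fintype _ _ (by simp)]
      simp only [mul_pow, Finset.prod_mul_distrib, Finset.prod_pow_eq_pow_sum]
      rw [← Polynomial.C_mul_X_pow_eq_monomial, Finsupp.degree_eq_sum, map_mul, map_prod,
        Polynomial.algebraMap_eq]
      simp only [map_pow, mul_assoc]
    have h2 : homogeneousComponent n (monomial e c) =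
        if e.degree = n then monomial e c else 0 := by
      simp only [homogeneousComponent_of_mem (isHomogeneous_monomial c rfl), eq_comm (a := n)]
    rw [h1, h2, Polynomial.coeff_monomial]
    split_ifs with h
    · rw [eval_monomial, Finsupp.prod_fintype _ _ (by simp)]
    · simp
  | add p q hp hq => simp [hp, hq]

theorem mem_ker_lineMap_iff (v : Fin s → K) (g : MvPolynomial (Fin s) K) :
    g ∈ RingHom.ker (lineMap v) ↔ ∀ n, eval v (homogeneousComponent n g) = 0 := by
  rw [RingHom.mem_ker, Polynomial.ext_iff]
  simp [coeff_lineMap]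

theorem mem_ker_lineMap_of_isHomogeneous {v : Fin s → K} {g : MvPolynomial (Fin s) K} {n : ℕ}
    (hg : g.IsHomogeneous n) (h : eval v g = 0) : g ∈ RingHom.ker (lineMap v) := by
  rw [mem_ker_lineMap_iff]
  intro m
  rw [homogeneousComponent_of_mem hg]
  split_ifs <;> simp [h]

theorem lineMap_surjective {v : Fin s → K} (hv : v ≠ 0) : Function.Surjective (lineMap v) := by
  obtain ⟨i, hi⟩ := Function.ne_iff.1 hv
  intro p
  refine ⟨Polynomial.aeval (C (v i)⁻¹ * X i) p, ?_⟩
  rw [← Polynomial.aeval_algHom_apply]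
  have : lineMap v (C (v i)⁻¹ * X i) = Polynomial.X := by
    rw [map_mul, lineMap, aeval_X, ← algebraMap_eq, AlgHom.commutes, Polynomial.algebraMap_eq,
      ← mul_assoc, ← map_mul, inv_mul_cancel₀ (by simpa using hi), map_one, one_mul]
  rw [this, Polynomial.aeval_X_left_apply]

/-! ### Krull dimension one -/

theorem one_le_ringKrullDim_quotient {J : Ideal (MvPolynomial (Fin s) K)} {v : Fin s → K}
    (hv : v ≠ 0) (h : J ≤ RingHom.ker (lineMap v)) :
    1 ≤ ringKrullDim (MvPolynomial (Fin s) K ⧸ J) := by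
  rw [← IsPrincipalIdealRing.ringKrullDim_eq_one (Polynomial K) (Polynomial.not_isField K)]
  exact ringKrullDim_le_of_surjective (Ideal.Quotient.lift J (lineMap v).toRingHom fun g hg => h hg)
    (Ideal.Quotient.lift_surjective_of_surjective _ _ (lineMap_surjective hv))

theorem isPrincipalIdealRing_of_forall_sub_mem {R : Type*} [CommRing R]
    (φ : MvPolynomial (Fin s) K →+* R) (hφ : Function.Surjective φ) (i : Fin s) (c : Fin s → K)
    (h : ∀ j, φ (X j - C (c j) * X i) = 0) : IsPrincipalIdealRing R := by
  refine IsPrincipalIdealRing.of_surjective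
    (Polynomial.eval₂RingHom (φ.comp C) (φ (X i))) fun y => ?_
  obtain ⟨g, rfl⟩ := hφ y
  induction g using MvPolynomial.induction_on with
  | C a => exact ⟨Polynomial.C a, by simp⟩
  | add p q hp hq =>
    obtain ⟨p', hp⟩ := hp
    obtain ⟨q', hq⟩ := hq
    exact ⟨p' + q', by rw [map_add, hp, hq, map_add]⟩
  | mul_X p j hp =>
    obtain ⟨p', hp⟩ := hp
    refine ⟨p' * (Polynomial.C (c j) * Polynomial.X), ?_⟩
    have hj := h j
    rw [map_sub, sub_eq_zero, map_mul] at hj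
    rw [map_mul, hp, map_mul, map_mul, hj]
    simp

/-- Modulo such a prime `P` every variable is a multiple of one `t_i`, so `S/P` is a quotient of
`K[T]` and hence a principal ideal domain. Primes strictly above `P` are therefore maximal. -/
theorem ringKrullDim_quotient_le_one {J : Ideal (MvPolynomial (Fin s) K)}
    (h : ∀ P : Ideal (MvPolynomial (Fin s) K), P.IsPrime → J ≤ P →
      ∃ (i : Fin s) (c : Fin s → K), ∀ j, X j - C (c j) * X i ∈ P) :
    ringKrullDim (MvPolynomial (Fin s) K ⧸ J) ≤ 1 := by
  rw [← Nat.cast_one, ← Ring.krullDimLE_iff]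
  refine Ring.KrullDimLE.mk₁ fun Q hQ => or_iff_not_imp_left.2 fun hQ' => ?_
  rw [minimalPrimes_eq_minimals, Set.notMem_ofPred_iff, not_minimal_iff_exists_lt hQ] at hQ'
  obtain ⟨P, hPQ, hP⟩ := hQ'
  have hP' : P.IsPrime := hP
  obtain ⟨i, c, hc⟩ := h (P.comap (Ideal.Quotient.mk J)) inferInstance fun g hg => by
    rw [Ideal.mem_comap, Ideal.Quotient.eq_zero_iff_mem.2 hg]; exact P.zero_mem
  have := isPrincipalIdealRing_of_forall_sub_mem (R := (MvPolynomial (Fin s) K ⧸ J) ⧸ P)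
    ((Ideal.Quotient.mk P).comp (Ideal.Quotient.mk J))
    (Ideal.Quotient.mk_surjective.comp Ideal.Quotient.mk_surjective) i c
    fun j => by simpa using Ideal.Quotient.eq_zero_iff_mem.2 (Ideal.mem_comap.1 (hc j))
  have hmax : (Q.map (Ideal.Quotient.mk P)).IsMaximal := by
    have : (Q.map (Ideal.Quotient.mk P)).IsPrime :=
      Ideal.map_isPrime_of_surjective Ideal.Quotient.mk_surjective (by simpa using hPQ.le)
    refine IsPrime.to_maximal_ideal (S := Q.map (Ideal.Quotient.mk P)) ?_
    rw [ne_eq, Ideal.map_eq_bot_iff_le_ker, Ideal.mk_ker]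
    exact hPQ.not_ge
  have := Ideal.comap_isMaximal_of_surjective (Ideal.Quotient.mk P) Ideal.Quotient.mk_surjective
    (K := Q.map (Ideal.Quotient.mk P))
  rwa [Ideal.comap_map_of_surjective _ Ideal.Quotient.mk_surjective, ← RingHom.ker_eq_comap_bot,
    Ideal.mk_ker, sup_eq_left.2 hPQ.le] at this

/-! ### Counting reduced exponents -/

/-- `e` is the exponent of a monomial divisible by none of the `t_i t_j^{d_j}`, `i < j`. -/
def IsReduced (d : Fin s → ℕ) (e : Fin s →₀ ℕ) : Prop :=
  ∀ i j, i < j → 0 < e i → e j < d j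

theorem exists_lowest {e : Fin s →₀ ℕ} (he : e ≠ 0) : ∃ i, 0 < e i ∧ ∀ j < i, e j = 0 := by
  obtain ⟨i, hi⟩ := Finsupp.ne_iff.1 he
  have hne : e.support.Nonempty := ⟨i, by simpa using hi⟩
  refine ⟨e.support.min' hne, Nat.pos_of_ne_zero ?_, fun j hj => ?_⟩
  · simpa using e.support.min'_mem hne
  · by_contra h
    exact (e.support.min'_le j (by simpa using h)).not_gt hj

/-- The exponents of degree `n` of the monomials that are divisible by `t^a`, not divisible by any
`t_j^{d_j}` with `j > i`, and in which `t_i` is the variable of smallest index. -/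
def cell (d : Fin s → ℕ) (a : Fin s →₀ ℕ) (n : ℕ) (i : Fin s) : Finset (Fin s →₀ ℕ) :=
  {e ∈ Finset.finsuppAntidiag Finset.univ n |
    0 < e i ∧ (∀ j < i, e j = 0) ∧ (∀ j, i < j → e j < d j) ∧ a ≤ e}

theorem mem_cell {d : Fin s → ℕ} {a : Fin s →₀ ℕ} {n : ℕ} {i : Fin s} {e : Fin s →₀ ℕ} :
    e ∈ cell d a n i ↔ e.degree = n ∧
      0 < e i ∧ (∀ j < i, e j = 0) ∧ (∀ j, i < j → e j < d j) ∧ a ≤ e := by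
  simp [cell, Finset.mem_finsuppAntidiag, Finsupp.degree_eq_sum]

theorem cell_disjoint (d : Fin s → ℕ) (a : Fin s →₀ ℕ) (n : ℕ) {i j : Fin s} (hij : i ≠ j) :
    Disjoint (cell d a n i) (cell d a n j) := by
  rw [Finset.disjoint_left]
  intro e hi hj
  rw [mem_cell] at hi hj
  rcases lt_or_gt_of_ne hij with h | h
  · exact hi.2.1.ne' (hj.2.2.1 i h)
  · exact hj.2.1.ne' (hi.2.2.1 j h)

theorem card_cell (d : Fin s → ℕ) (a : Fin s →₀ ℕ) (i : Fin s) (ha : ∀ j < i, a j = 0)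
    {n : ℕ} (hn : ∑ j, d j + a i < n) :
    (cell d a n i).card = ∏ j ∈ Finset.Ioi i, (d j - a j) := by
  classical
  let B : Finset (Fin s → ℕ) :=
    Fintype.piFinset fun j => if i < j then Finset.Ico (a j) (d j) else {0}
  have hB : B.card = ∏ j ∈ Finset.Ioi i, (d j - a j) := by
    rw [Fintype.card_piFinset, ← Finset.filter_lt_eq_Ioi, Finset.prod_filter]
    refine Finset.prod_congr rfl fun j _ => ?_
    split_ifs <;> simp
  rw [← hB]
  -- The exponent `n - ∑ x_j` left for `t_i` is then positive and at least `a_i`.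
  have hsum : ∀ x ∈ B, ∑ j, x j + a i < n := fun x hx => by
    refine lt_of_le_of_lt (Nat.add_le_add_right (Finset.sum_le_sum fun j _ => ?_) _) hn
    have := Fintype.mem_piFinset.1 hx j
    split_ifs at this with h
    · exact (Finset.mem_Ico.1 this).2.le
    · simp_all
  symm
  refine Finset.card_bij
    (fun x _ => Finsupp.equivFunOnFinite.symm x + Finsupp.single i (n - ∑ j, x j)) ?_ ?_ ?_
  · intro x hx
    have hs := hsum x hx
    have hx' : ∀ j, _ := Fintype.mem_piFinset.1 hx
    have hxi : x i = 0 := by simpa using hx' i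
    rw [mem_cell]
    refine ⟨?_, ?_, fun j hj => ?_, fun j hj => ?_, fun j => ?_⟩
    · rw [map_add, Finsupp.degree_single, Finsupp.degree_eq_sum]
      simp only [Finsupp.equivFunOnFinite_symm_apply_apply]
      omega
    · simp; omega
    · have := hx' j
      rw [if_neg hj.not_gt, Finset.mem_singleton] at this
      simp [this, hj.ne']
    · have := hx' j
      rw [if_pos hj, Finset.mem_Ico] at this
      simpa [Finsupp.single_apply, hj.ne] using this.2
    · rcases lt_trichotomy j i with hj | rfl | hj
      · simp [ha j hj]
      · simp; omega
      · have := hx' j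
        rw [if_pos hj, Finset.mem_Ico] at this
        simpa [Finsupp.single_apply, hj.ne] using this.1
  · intro x hx y hy h
    funext j
    by_cases hj : i = j
    · subst hj
      have h1 := Fintype.mem_piFinset.1 hx i
      have h2 := Fintype.mem_piFinset.1 hy i
      simp_all
    · simpa [Finsupp.single_apply, hj] using DFunLike.congr_fun h j
  · intro e he
    rw [mem_cell] at he
    obtain ⟨hdeg, -, h0, h1, h2⟩ := he
    have hsum : ∑ j, Function.update e i 0 j + e i = n := by
      rw [← hdeg, Finsupp.degree_eq_sum, Finset.sum_update_of_mem (Finset.mem_univ i), zero_add,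
        add_comm, ← Finset.sum_sdiff (Finset.singleton_subset_iff.2 (Finset.mem_univ i)),
        Finset.sum_singleton, add_comm]
    refine ⟨Function.update e i 0, ?_, ?_⟩
    · refine Fintype.mem_piFinset.2 fun j => ?_
      rcases lt_trichotomy j i with hj | rfl | hj
      · simp [hj.not_gt, hj.ne, h0 j hj]
      · simp
      · simp [hj, hj.ne', h1 j hj, h2 j]
    · ext j
      by_cases hj : i = j
      · subst hj
        simp; omega
      · simp [hj, Function.update_of_ne (Ne.symm hj)]

theorem setOf_isReduced_eq (d : Fin s → ℕ) (a : Fin s →₀ ℕ) {n : ℕ} (hn : 0 < n) :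
    {e : Fin s →₀ ℕ | e.degree = n ∧ IsReduced d e ∧ a ≤ e} =
      ↑(Finset.univ.biUnion (cell d a n)) := by
  ext e
  simp only [Set.mem_ofPred_eq, Finset.coe_biUnion, Finset.coe_univ, Set.mem_univ, Set.iUnion_true,
    Set.mem_iUnion, Finset.mem_coe, mem_cell]
  constructor
  · rintro ⟨h1, h2, h3⟩
    have h0 : e ≠ 0 := by rintro rfl; simp at h1; omega
    obtain ⟨i, hi, hi'⟩ := exists_lowest h0
    exact ⟨i, h1, hi, hi', fun j hj => h2 i j hj hi, h3⟩
  · rintro ⟨i, h1, hi, hi', h2, h3⟩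
    refine ⟨h1, fun j k hjk hj => h2 k ?_, h3⟩
    refine lt_of_le_of_lt (not_lt.1 fun h => hj.ne' (hi' j h)) hjk

theorem ncard_isReduced (d : Fin s → ℕ) (a : Fin s →₀ ℕ) (r : Fin s) (hlow : ∀ i < r, a i = 0)
    (har : 0 < a r) {n : ℕ} (hn : ∑ j, d j + ∑ j, a j < n) :
    {e : Fin s →₀ ℕ | e.degree = n ∧ IsReduced d e ∧ a ≤ e}.ncard =
      ∑ i ∈ Finset.Iic r, ∏ j ∈ Finset.Ioi i, (d j - a j) := by
  classical
  rw [setOf_isReduced_eq d a (by omega), Set.ncard_coe_finset,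
    Finset.card_biUnion fun i _ j _ h => cell_disjoint d a n h]
  rw [← Finset.sum_subset (Finset.subset_univ (Finset.Iic r))]
  · refine Finset.sum_congr rfl fun i hi => card_cell d a i
      (fun j hj => hlow j (hj.trans_le (Finset.mem_Iic.1 hi))) ?_
    have := Finset.single_le_sum (f := fun j => a j) (fun j _ => Nat.zero_le _) (Finset.mem_univ i)
    omega
  -- A multiple of `t^a` contains `t_r`, so its lowest variable cannot lie above `r`.
  · intro i _ hi
    rw [Finset.card_eq_zero, Finset.eq_empty_iff_forall_notMem]
    intro e he
    rw [mem_cell] at he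
    have h1 := he.2.2.1 r (by simpa using hi)
    have h2 := he.2.2.2.2 r
    omega

theorem ncard_isReduced_all (d : Fin s → ℕ) {n : ℕ} (hn : ∑ j, d j < n) :
    {e : Fin s →₀ ℕ | e.degree = n ∧ IsReduced d e}.ncard = ∑ i, ∏ j ∈ Finset.Ioi i, d j := by
  classical
  have h := setOf_isReduced_eq d 0 (n := n) (by omega)
  simp only [zero_le, and_true] at h
  rw [h, Set.ncard_coe_finset, Finset.card_biUnion fun i _ j _ h => cell_disjoint d 0 n h]
  exact Finset.sum_congr rfl fun i hi => card_cell d 0 i (fun j hj => rfl) (by simpa using hn)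

/-! ### Homogeneous polynomials with reduced exponents -/

/-- Let `i` be the largest index of a lowest variable among the monomials of `g`. Setting `t_j = 0`
for `j < i` and `t_i = 1` leaves exactly the monomials with lowest variable `t_i`. The result has
degree less than `|A_j|` in each `t_j` and vanishes on the product of the `A_j`, so it is zero. -/
theorem eq_zero_of_isReduced_of_eval_eq_zero [NeZero s] {A : Fin s → Finset K}
    (h0 : ∀ i, (0 : K) ∈ A i) (h1 : ∀ i, (1 : K) ∈ A i) {n : ℕ}
    {g : MvPolynomial (Fin s) K} (hg : g.IsHomogeneous n)
    (hred : ∀ e ∈ g.support, IsReduced (fun i => (A i).card) e)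
    (heval : ∀ v : Fin s → K, v ≠ 0 → (∀ i, v i ∈ A i) → eval v g = 0) : g = 0 := by
  classical
  by_contra hne
  have hdeg : ∀ e ∈ g.support, e.degree = n := fun e he => by
    have := hg (mem_support_iff.1 he)
    rwa [Finsupp.degree_eq_weight_one]
  obtain ⟨e₀, he₀⟩ : ∃ e, e ∈ g.support := support_nonempty.2 hne
  rcases Nat.eq_zero_or_pos n with rfl | hn
  · have := heval 1 (fun h => one_ne_zero (congrFun h 0)) (fun i => h1 i)
    rw [← totalDegree_zero_iff_isHomogeneous, totalDegree_eq_zero_iff_eq_C] at hg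
    rw [hg, eval_C] at this
    exact hne (by rw [hg, this, C_0])
  let Q : Fin s → Prop := fun i => ∃ e ∈ g.support, 0 < e i ∧ ∀ j < i, e j = 0
  have hQ : ∀ e ∈ g.support, ∃ i, 0 < e i ∧ ∀ j < i, e j = 0 := fun e he =>
    exists_lowest (by rintro rfl; have := hdeg 0 he; simp at this; omega)
  obtain ⟨i, ⟨e₁, he₁, hi₁, hlow₁⟩, hmax⟩ : ∃ i, Q i ∧ ∀ j, Q j → j ≤ i := by
    obtain ⟨i, hi⟩ := hQ e₀ he₀
    obtain ⟨m, hm, hm'⟩ := Finset.exists_max_image (Finset.univ.filter Q) id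
      ⟨i, by simpa using ⟨e₀, he₀, hi⟩⟩
    exact ⟨m, by simpa using hm, fun j hj => hm' j (by simpa using hj)⟩
  let F := g.support.filter fun e => ∀ j < i, e j = 0
  have hF : ∀ e ∈ F, e ∈ g.support ∧ (∀ j < i, e j = 0) ∧ 0 < e i := fun e he => by
    obtain ⟨he, hlow⟩ := Finset.mem_filter.1 he
    obtain ⟨k, hk, hk'⟩ := hQ e he
    have h2 : ¬ k < i := fun h => hk.ne' (hlow k h)
    have := le_antisymm (hmax k ⟨e, he, hk, hk'⟩) (not_lt.1 h2)
    exact ⟨he, hlow, this ▸ hk⟩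
  let h : MvPolynomial (Fin s) K := ∑ e ∈ F, monomial (e.erase i) (coeff e g)
  have hh : h = 0 := by
    refine eq_zero_of_eval_zero_at_prod_finset h A (fun j => ?_) fun x hx => ?_
    · refine lt_of_le_of_lt (degreeOf_sum_le _ _ _) ((Finset.sup_lt_iff ?_).2 fun e he => ?_)
      · exact Finset.card_pos.2 ⟨0, h0 j⟩
      · obtain ⟨he, hlow, hei⟩ := hF e he
        rw [degreeOf_monomial_eq _ _ (mem_support_iff.1 he)]
        rcases lt_trichotomy j i with hj | rfl | hj
        · rw [Finsupp.erase_ne hj.ne, hlow j hj]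
          exact Finset.card_pos.2 ⟨0, h0 j⟩
        · rw [Finsupp.erase_same]
          exact Finset.card_pos.2 ⟨0, h0 j⟩
        · rw [Finsupp.erase_ne hj.ne']
          exact hred e he i j hj hei
    · let v : Fin s → K := fun j => if j < i then 0 else if j = i then 1 else x j
      have hv : eval v g = 0 := by
        refine heval v (fun h => ?_) fun j => ?_
        · have := congrFun h i
          simp [v] at this
        · simp only [v]
          split_ifs
          exacts [h0 j, h1 j, hx j]
      rw [← hv, eval_eq' v g, map_sum]
      rw [← Finset.sum_subset (Finset.filter_subset (fun e => ∀ j < i, e j = 0) g.support)]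
      · refine Finset.sum_congr rfl fun e he => ?_
        rw [eval_monomial, Finsupp.prod_fintype _ _ (by simp)]
        refine congrArg _ (Finset.prod_congr rfl fun j _ => ?_)
        obtain ⟨he, hlow, hei⟩ := hF e he
        rcases lt_trichotomy j i with hj | rfl | hj
        · rw [Finsupp.erase_ne hj.ne, hlow j hj, pow_zero, pow_zero]
        · simp [v]
        · simp [v, hj.not_gt, hj.ne', Finsupp.erase_ne]
      · intro e he he'
        have : ∃ j < i, e j ≠ 0 := by
          by_contra hc
          push Not at hc
          exact he' (Finset.mem_filter.2 ⟨he, hc⟩)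
        obtain ⟨j, hj, hej⟩ := this
        rw [Finset.prod_eq_zero (Finset.mem_univ j), mul_zero]
        simp [v, hj, hej]
  have he₁F : e₁ ∈ F := Finset.mem_filter.2 ⟨he₁, hlow₁⟩
  -- No cancellation occurs when `t_i = 1`: homogeneity recovers the erased exponent.
  have hcoeff : coeff (e₁.erase i) h = coeff e₁ g := by
    rw [coeff_sum, Finset.sum_eq_single e₁]
    · simp
    · intro e he hne
      rw [coeff_monomial, if_neg]
      intro heq
      refine hne ?_
      have hd := (hdeg e (hF e he).1).trans (hdeg e₁ he₁).symm
      rw [← Finsupp.single_add_erase i e, ← Finsupp.single_add_erase i e₁, heq, map_add, map_add,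
        Finsupp.degree_single, Finsupp.degree_single] at hd
      rw [← Finsupp.single_add_erase i e, ← Finsupp.single_add_erase i e₁, heq,
        Nat.add_right_cancel hd]
    · exact fun h => absurd he₁F h
  rw [hh, coeff_zero] at hcoeff
  exact mem_support_iff.1 he₁ hcoeff.symm

/-! ### The vanishing ideal -/

theorem vanishingIdeal_le_ker_lineMap {X : Set (Projectivization K (Fin s → K))}
    {v : Fin s → K} (hv : v ≠ 0) (h : Projectivization.mk K v hv ∈ X) :
    vanishingIdeal X ≤ RingHom.ker (lineMap v) := by
  rw [vanishingIdeal, Ideal.span_le]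
  rintro g ⟨⟨n, hn⟩, hg⟩
  exact mem_ker_lineMap_of_isHomogeneous hn (hg _ h v hv rfl)

theorem homogeneousComponent_mem_vanishingIdeal {X : Set (Projectivization K (Fin s → K))}
    {g : MvPolynomial (Fin s) K} (hg : g ∈ vanishingIdeal X) (n : ℕ) :
    homogeneousComponent n g ∈ vanishingIdeal X := by
  refine Ideal.subset_span ⟨⟨n, homogeneousComponent_isHomogeneous n g⟩, ?_⟩
  rintro p hp v hv rfl
  exact (mem_ker_lineMap_iff v g).1 (vanishingIdeal_le_ker_lineMap hv hp hg) n

theorem eq_zero_of_isReduced_of_mem_vanishingIdeal [NeZero s] {A : Fin s → Finset K} (hA : IsNested A)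
    {g : MvPolynomial (Fin s) K} (hg : g ∈ vanishingIdeal (cartesianSet A))
    (hred : ∀ e ∈ g.support, IsReduced (fun i => (A i).card) e) : g = 0 := by
  rw [← sum_homogeneousComponent g]
  refine Finset.sum_eq_zero fun n _ => ?_
  refine eq_zero_of_isReduced_of_eval_eq_zero hA.zero_mem hA.one_mem
    (homogeneousComponent_isHomogeneous n g) (fun e he => ?_) fun v hv hvA => ?_
  · rw [support_homogeneousComponent] at he
    exact hred e (Finset.mem_filter.1 he).1
  · exact (mem_ker_lineMap_iff v g).1
      (vanishingIdeal_le_ker_lineMap (X := cartesianSet A) hv ⟨v, hv, hvA, rfl⟩ hg) n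

/-! ### The Gröbner basis -/

/-- The polynomial `t_i ∏_{c ∈ A_j} (t_j - c t_i)`. -/
def cartesianRelation (A : Fin s → Finset K) (i j : Fin s) : MvPolynomial (Fin s) K :=
  X i * ∏ c ∈ A j, (X j - C c * X i)

/-- The exponent of `t_i t_j^{d_j}`. -/
def relationExponent (d : Fin s → ℕ) (i j : Fin s) : Fin s →₀ ℕ :=
  Finsupp.single i 1 + d j • Finsupp.single j 1

theorem isReduced_iff (d : Fin s → ℕ) (e : Fin s →₀ ℕ) :
    IsReduced d e ↔ ∀ i j, i < j → ¬ relationExponent d i j ≤ e := by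
  refine forall₂_congr fun i j => imp_congr_right fun hij => ?_
  rw [imp_iff_not_or, ← not_le, ← not_le, ← not_and_or, not_iff_not, Finsupp.le_def]
  constructor
  · rintro ⟨hi, hj⟩ k
    by_cases hk : i = k
    · subst hk
      simpa [relationExponent, hij.ne, Nat.one_le_iff_ne_zero] using hi
    · by_cases hk' : j = k
      · subst hk'
        simpa [relationExponent, hij.ne] using hj
      · simp [relationExponent, hk, hk']
  · intro h
    have h1 := h i
    have h2 := h j
    simp only [relationExponent, Finsupp.coe_add, Finsupp.coe_smul, Pi.add_apply, Pi.smul_apply,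
      Finsupp.single_apply, hij.ne, hij.ne', if_true, if_false, smul_eq_mul, mul_one, mul_zero,
      add_zero, zero_add] at h1 h2
    exact ⟨not_le.2 h1, h2⟩

theorem cartesianRelation_mem {A : Fin s → Finset K} (hA : IsNested A) {i j : Fin s}
    (hij : i < j) : cartesianRelation A i j ∈ vanishingIdeal (cartesianSet A) := by
  have hhom : (cartesianRelation A i j).IsHomogeneous (1 + ∑ c ∈ A j, 1) :=
    (isHomogeneous_X K i).mul (IsHomogeneous.prod _ _ _ fun c _ =>
      (isHomogeneous_X K j).sub (isHomogeneous_C_mul_X c i))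
  refine Ideal.subset_span ⟨⟨_, hhom⟩, ?_⟩
  rintro _ ⟨v, hv, hvA, rfl⟩ w hw hwv
  obtain ⟨b, rfl⟩ := (Projectivization.mk_eq_mk_iff' K w v hw hv).1 hwv
  simp only [cartesianRelation, map_mul, map_prod, map_sub, eval_X, eval_C, Pi.smul_apply,
    smul_eq_mul]
  by_cases hi : v i = 0
  · simp [hi]
  -- The vanishing factor is the one with `c = v_j / v_i`; it stays zero after scaling by `b`.
  · rw [Finset.prod_eq_zero (hA.div_mem i j hij _ (hvA j) _ (hvA i) hi), mul_zero]
    field_simp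
    ring

theorem monic_cartesianRelation_and_degree (A : Fin s → Finset K) {i j : Fin s} (hij : i < j) :
    (lexOrder s).Monic (cartesianRelation A i j) ∧
      (lexOrder s).degree (cartesianRelation A i j) =
        relationExponent (fun i => (A i).card) i j := by
  have hlt : ∀ c : K, (lexOrder s).toSyn ((lexOrder s).degree (C c * X i)) <
      (lexOrder s).toSyn ((lexOrder s).degree (X j : MvPolynomial (Fin s) K)) := fun c => by
    rw [MonomialOrder.degree_X]
    refine lt_of_le_of_lt (b := (lexOrder s).toSyn (Finsupp.single i 1)) ?_ ?_
    · rw [C_mul_X_eq_monomial]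
      exact MonomialOrder.degree_monomial_le c
    · rw [lexOrder_lt_iff]
      exact ⟨j, fun k hk => by simp [hk.ne', (hij.trans hk).ne'], by simp [hij.ne]⟩
  have hdeg : ∀ c : K, (lexOrder s).degree (X j - C c * X i) = Finsupp.single j 1 := fun c => by
    rw [MonomialOrder.degree_sub_of_lt (hlt c), MonomialOrder.degree_X]
  have hmon : ∀ c : K, (lexOrder s).Monic (X j - C c * X i) := fun c => by
    rw [MonomialOrder.Monic, MonomialOrder.leadingCoeff_sub_of_lt (hlt c)]
    exact MonomialOrder.monic_X
  refine ⟨MonomialOrder.monic_X.mul (MonomialOrder.Monic.prod fun c _ => hmon c), ?_⟩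
  rw [cartesianRelation, MonomialOrder.degree_mul (X_ne_zero i)
    (Finset.prod_ne_zero_iff.2 fun c _ => (hmon c).ne_zero), MonomialOrder.degree_X,
    MonomialOrder.degree_prod fun c _ => (hmon c).ne_zero, Finset.sum_congr rfl fun c _ => hdeg c,
    Finset.sum_const, relationExponent]

/-- The Gröbner basis of the vanishing ideal of a projective nested cartesian set. -/
def groebnerBasis (A : Fin s → Finset K) : Set (MvPolynomial (Fin s) K) :=
  {g | ∃ i j, i < j ∧ g = cartesianRelation A i j}

theorem isUnit_leadingCoeff_of_mem_groebnerBasis {A : Fin s → Finset K}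
    {b : MvPolynomial (Fin s) K} (hb : b ∈ groebnerBasis A) :
    IsUnit ((lexOrder s).leadingCoeff b) := by
  obtain ⟨i, j, hij, rfl⟩ := hb
  rw [(monic_cartesianRelation_and_degree A hij).1.leadingCoeff_eq_one]
  exact isUnit_one

theorem isReduced_of_forall_groebnerBasis {A : Fin s → Finset K} {e : Fin s →₀ ℕ}
    (h : ∀ b ∈ groebnerBasis A, ¬ (lexOrder s).degree b ≤ e) :
    IsReduced (fun i => (A i).card) e := by
  rw [isReduced_iff]
  intro i j hij
  rw [← (monic_cartesianRelation_and_degree A hij).2]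
  exact h _ ⟨i, j, hij, rfl⟩

theorem linearCombination_mem {J : Ideal (MvPolynomial (Fin s) K)}
    {B : Set (MvPolynomial (Fin s) K)} (hB : B ⊆ J) (g : B →₀ MvPolynomial (Fin s) K) :
    Finsupp.linearCombination _ (fun b : B => (b : MvPolynomial (Fin s) K)) g ∈ J :=
  Submodule.sum_mem _ fun b _ => J.smul_mem _ (hB b.2)

/-- Division by the basis leaves a reduced remainder in the ideal, hence zero. Then `g` is a sum of
terms `b * q b` of degree at most that of `g`, and a term in which the initial monomial of `g`
occurs must have that same initial monomial, which is divisible by that of `b`. -/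
theorem not_isReduced_degree [NeZero s] {A : Fin s → Finset K} (hA : IsNested A)
    {g : MvPolynomial (Fin s) K} (hg : g ∈ vanishingIdeal (cartesianSet A)) (hg0 : g ≠ 0) :
    ¬ IsReduced (fun i => (A i).card) ((lexOrder s).degree g) := by
  intro hred
  obtain ⟨q, r, hqr, hq, hr⟩ := (lexOrder s).div_set
    (fun b hb => isUnit_leadingCoeff_of_mem_groebnerBasis (A := A) hb) g
  have hB : groebnerBasis A ⊆ vanishingIdeal (cartesianSet A) := by
    rintro _ ⟨i, j, hij, rfl⟩
    exact cartesianRelation_mem hA hij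
  have hr0 : r = 0 := by
    refine eq_zero_of_isReduced_of_mem_vanishingIdeal hA ?_
      fun e he => isReduced_of_forall_groebnerBasis (hr e he)
    rw [← sub_eq_iff_eq_add'.2 hqr]
    exact sub_mem hg (linearCombination_mem hB q)
  rw [hr0, add_zero] at hqr
  have hc := ((lexOrder s).coeff_degree_ne_zero_iff).2 hg0
  obtain ⟨b, hb⟩ : ∃ b : groebnerBasis A,
      coeff ((lexOrder s).degree g) ((b : MvPolynomial (Fin s) K) * q b) ≠ 0 := by
    by_contra! h
    have hsum : coeff ((lexOrder s).degree g)
        (Finsupp.linearCombination _ (fun b : groebnerBasis A => (b : MvPolynomial _ K)) q) = 0 := by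
      rw [Finsupp.linearCombination_apply, Finsupp.sum, coeff_sum]
      exact Finset.sum_eq_zero fun b _ => by rw [smul_eq_mul, mul_comm]; exact h b
    rw [← hqr] at hsum
    exact hc hsum
  have hdeg : (lexOrder s).degree ((b : MvPolynomial (Fin s) K) * q b) =
      (lexOrder s).degree g :=
    (lexOrder s).toSyn.injective (le_antisymm (hq b)
      ((lexOrder s).le_degree (mem_support_iff.2 hb)))
  have hbq : (b : MvPolynomial (Fin s) K) * q b ≠ 0 := fun h => hb (by rw [h, coeff_zero])
  rw [MonomialOrder.degree_mul (left_ne_zero_of_mul hbq) (right_ne_zero_of_mul hbq)] at hdeg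
  obtain ⟨i, j, hij, hb'⟩ := b.2
  rw [isReduced_iff] at hred
  refine hred i j hij ?_
  rw [← hdeg, hb', (monic_cartesianRelation_and_degree A hij).2]
  exact le_self_add

/-- The initial exponents of the vanishing ideal are exactly the non-reduced ones. -/
theorem isReduced_iff_isStandardMonomial [NeZero s] {A : Fin s → Finset K} (hA : IsNested A)
    {e : Fin s →₀ ℕ} :
    IsStandardMonomial (lexOrder s) (vanishingIdeal (cartesianSet A)) e ↔
      IsReduced (fun i => (A i).card) e := by
  constructor
  · intro h
    rw [isReduced_iff]
    intro i j hij hle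
    obtain ⟨hm, hd⟩ := monic_cartesianRelation_and_degree A hij
    have hmon : monomial (e - relationExponent (fun i => (A i).card) i j) (1 : K) ≠ 0 := by simp
    refine h (monomial (e - relationExponent (fun i => (A i).card) i j) 1 *
      cartesianRelation A i j) (Ideal.mul_mem_left _ _ (cartesianRelation_mem hA hij))
      (mul_ne_zero hmon hm.ne_zero) ?_
    classical
    rw [MonomialOrder.degree_mul hmon hm.ne_zero, hd, MonomialOrder.degree_monomial,
      if_neg one_ne_zero, tsub_add_cancel_of_le hle]
  · rintro h g hg hg0 rfl
    exact not_isReduced_degree hA hg hg0 h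

theorem initialIdeal_vanishingIdeal [NeZero s] {A : Fin s → Finset K} (hA : IsNested A) :
    initialIdeal (lexOrder s) (vanishingIdeal (cartesianSet A)) =
      Ideal.span ((fun e => monomial e (1 : K)) ''
        {e | ¬ IsReduced (fun i => (A i).card) e}) := by
  rw [initialIdeal]
  congr 1
  ext h
  simp only [← isReduced_iff_isStandardMonomial hA, IsStandardMonomial, Set.mem_ofPred_eq,
    Set.mem_image]
  constructor
  · rintro ⟨g, hg, hg0, rfl⟩
    exact ⟨_, fun h => h g hg hg0 rfl, rfl⟩
  · rintro ⟨e, he, rfl⟩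
    push Not at he
    obtain ⟨g, hg, hg0, rfl⟩ := he
    exact ⟨g, hg, hg0, rfl⟩

/-! ### Hilbert functions from standard monomials -/

theorem finrank_restrictSupport (T : Set (Fin s →₀ ℕ)) :
    Module.finrank K (restrictSupport K T) = T.ncard := by
  rw [Module.finrank_eq_nat_card_basis (basisRestrictSupport K T), Nat.card_coe_set_eq]

/-- The hypotheses say that the span of the monomials in `T` is a complement of `J_n` in `S_n`. -/
theorem hilbertFunction_eq_ncard {J : Ideal (MvPolynomial (Fin s) K)} {n : ℕ}
    {T : Set (Fin s →₀ ℕ)} (hT : ∀ e ∈ T, e.degree = n)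
    (hspan : ∀ g : MvPolynomial (Fin s) K, g.IsHomogeneous n →
      ∃ r ∈ restrictSupport K T, g - r ∈ J)
    (hind : ∀ r ∈ restrictSupport K T, r ∈ J → r = 0) :
    hilbertFunction J n = T.ncard := by
  have hle : restrictSupport K T ≤ homogeneousSubmodule (Fin s) K n := fun g hg => by
    rw [mem_homogeneousSubmodule]
    intro e he
    rw [← hT e (hg (mem_support_iff.2 he)), Finsupp.degree_eq_weight_one]
    rfl
  let φ := ((J.restrictScalars K).submoduleOf (homogeneousSubmodule (Fin s) K n)).mkQ ∘ₗ
    Submodule.inclusion hle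
  have hφ : Function.Bijective φ := by
    constructor
    · rw [← LinearMap.ker_eq_bot, LinearMap.ker_eq_bot']
      rintro ⟨r, hr⟩ h
      have h' : r ∈ J := (Submodule.Quotient.mk_eq_zero
        ((J.restrictScalars K).submoduleOf (homogeneousSubmodule (Fin s) K n))).1 h
      exact Subtype.ext (hind r hr h')
    · intro y
      obtain ⟨⟨g, hg⟩, rfl⟩ := Submodule.mkQ_surjective _ y
      obtain ⟨r, hr, hgr⟩ := hspan g hg
      refine ⟨⟨r, hr⟩, ?_⟩
      refine ((Submodule.Quotient.eq _).2 ?_).symm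
      exact hgr
  rw [hilbertFunction, ← (LinearEquiv.ofBijective φ hφ).finrank_eq, finrank_restrictSupport]

theorem hilbertFunction_span_monomial (N : Set (Fin s →₀ ℕ)) (n : ℕ) :
    hilbertFunction (Ideal.span ((fun e => monomial e (1 : K)) '' N)) n =
      {e : Fin s →₀ ℕ | e.degree = n ∧ ∀ m ∈ N, ¬ m ≤ e}.ncard := by
  classical
  refine hilbertFunction_eq_ncard (fun e he => he.1) (fun g hg => ?_) fun r hr hrJ => ?_
  · have hdeg : ∀ e ∈ g.support, e.degree = n := fun e he => by
      have := hg (mem_support_iff.1 he)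
      rwa [Finsupp.degree_eq_weight_one]
    let p : (Fin s →₀ ℕ) → Prop := fun e => ∀ m ∈ N, ¬ m ≤ e
    refine ⟨∑ e ∈ g.support.filter p, monomial e (coeff e g),
      Submodule.sum_mem _ fun e he => ?_, ?_⟩
    · rw [Finset.mem_filter] at he
      exact (monomial_mem_restrictSupport K).2 (Or.inl ⟨hdeg e he.1, he.2⟩)
    · have hg' : g - ∑ e ∈ g.support.filter p, monomial e (coeff e g) =
          ∑ e ∈ g.support.filter fun e => ¬ p e, monomial e (coeff e g) := by
        rw [sub_eq_iff_eq_add', Finset.sum_filter_add_sum_filter_not]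
        exact g.as_sum
      rw [hg']
      refine Submodule.sum_mem _ fun e he => ?_
      have hpe := (Finset.mem_filter.1 he).2
      simp only [p] at hpe
      push Not at hpe
      obtain ⟨m, hm, hme⟩ := hpe
      rw [mem_ideal_span_monomial_image]
      intro x hx
      obtain rfl := Finset.mem_singleton.1 (support_monomial_subset hx)
      exact ⟨m, hm, hme⟩
  · rw [mem_ideal_span_monomial_image] at hrJ
    by_contra hne
    obtain ⟨e, he⟩ := support_nonempty.2 hne
    obtain ⟨m, hm, hme⟩ := hrJ e he
    exact (hr he).2 m hm hme

theorem exists_remainder (m : MonomialOrder (Fin s)) {J : Ideal (MvPolynomial (Fin s) K)}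
    {B : Set (MvPolynomial (Fin s) K)} (hB : B ⊆ J) (hu : ∀ b ∈ B, IsUnit (m.leadingCoeff b))
    (g : MvPolynomial (Fin s) K) :
    ∃ r, g - r ∈ J ∧ ∀ e ∈ r.support, ∀ b ∈ B, ¬ m.degree b ≤ e := by
  obtain ⟨q, r, hqr, -, hr⟩ := m.div_set hu g
  refine ⟨r, ?_, hr⟩
  rw [sub_eq_iff_eq_add.2 hqr]
  exact linearCombination_mem hB q

theorem groebnerBasis_subset {A : Fin s → Finset K} (hA : IsNested A) :
    groebnerBasis A ⊆ vanishingIdeal (cartesianSet A) := by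
  rintro _ ⟨i, j, hij, rfl⟩
  exact cartesianRelation_mem hA hij

theorem hilbertFunction_vanishingIdeal [NeZero s] {A : Fin s → Finset K} (hA : IsNested A)
    (n : ℕ) :
    hilbertFunction (vanishingIdeal (cartesianSet A)) n =
      {e : Fin s →₀ ℕ | e.degree = n ∧ IsReduced (fun i => (A i).card) e}.ncard := by
  refine hilbertFunction_eq_ncard (fun e he => he.1) (fun g hg => ?_) fun r hr hrJ =>
    eq_zero_of_isReduced_of_mem_vanishingIdeal hA hrJ fun e he => (hr he).2
  obtain ⟨r, hgr, hr⟩ := exists_remainder (lexOrder s) (groebnerBasis_subset hA)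
    (fun b hb => isUnit_leadingCoeff_of_mem_groebnerBasis hb) g
  -- The division theorem does not assert that the remainder is homogeneous; its degree `n`
  -- component serves because the ideal is graded.
  refine ⟨homogeneousComponent n r, (mem_restrictSupport_iff K).2 fun e he => ?_, ?_⟩
  · rw [Finset.mem_coe, support_homogeneousComponent, Finset.mem_filter] at he
    exact ⟨he.2, isReduced_of_forall_groebnerBasis (hr e he.1)⟩
  · rw [← homogeneousComponent_eq_self hg, ← map_sub]
    exact homogeneousComponent_mem_vanishingIdeal hgr n

/-! ### Degrees -/

theorem hasDegree_of_eventually {J : Ideal (MvPolynomial (Fin s) K)} {D N : ℕ}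
    (hdim : ringKrullDim (MvPolynomial (Fin s) K ⧸ J) = 1)
    (h : ∀ n, N < n → hilbertFunction J n = D) : HasDegree J D := by
  refine Or.inl ⟨1, le_rfl, by simpa using hdim, ?_⟩
  refine tendsto_const_nhds.congr' ?_
  filter_upwards [Filter.eventually_gt_atTop N] with n hn
  simp [h n hn]

/-- Take the smallest `i` with `t_i ∉ P`: lower variables get coefficient `0`, higher ones come from
the hypothesis. This serves both the vanishing ideal and the monomial ideal, where `c = 0`. -/
theorem exists_forall_sub_mem_of_isPrime [NeZero s] {P : Ideal (MvPolynomial (Fin s) K)}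
    (h : ∀ i j, i < j → X i ∈ P ∨ ∃ c : K, X j - C c * X i ∈ P) :
    ∃ (i : Fin s) (c : Fin s → K), ∀ j, X j - C (c j) * X i ∈ P := by
  by_cases hX : ∀ i : Fin s, X i ∈ P
  · exact ⟨0, 0, fun j => by simpa using hX j⟩
  · push Not at hX
    obtain ⟨i, hi, hmin⟩ := WellFounded.has_min (wellFounded_lt (α := Fin s))
      {i | X i ∉ P} hX
    have : ∀ j, ∃ c : K, X j - C c * X i ∈ P := fun j => by
      rcases lt_trichotomy j i with hj | rfl | hj
      · exact ⟨0, by simpa using not_not.1 fun hc => hmin j hc hj⟩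
      · exact ⟨1, by simp⟩
      · exact (h i j hj).resolve_left hi
    choose c hc using this
    exact ⟨i, c, hc⟩

theorem ringKrullDim_vanishingIdeal [NeZero s] {A : Fin s → Finset K} (hA : IsNested A) :
    ringKrullDim (MvPolynomial (Fin s) K ⧸ vanishingIdeal (cartesianSet A)) = 1 := by
  refine le_antisymm (ringKrullDim_quotient_le_one fun P hP hle =>
    exists_forall_sub_mem_of_isPrime fun i j hij => ?_) ?_
  · have := hle (cartesianRelation_mem hA hij)
    rcases hP.mem_or_mem this with h | h
    · exact Or.inl h
    · obtain ⟨c, -, hc⟩ := (Ideal.IsPrime.prod_mem_iff (hp := hP)).1 h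
      exact Or.inr ⟨c, hc⟩
  · have h1 : (1 : Fin s → K) ≠ 0 := one_ne_zero
    exact one_le_ringKrullDim_quotient h1
      (vanishingIdeal_le_ker_lineMap h1 ⟨1, h1, fun i => hA.one_mem i, rfl⟩)

theorem hasDegree_vanishingIdeal [NeZero s] {A : Fin s → Finset K} (hA : IsNested A) :
    HasDegree (vanishingIdeal (cartesianSet A))
      (∑ i, ∏ j ∈ Finset.Ioi i, (A j).card) :=
  hasDegree_of_eventually (ringKrullDim_vanishingIdeal hA) fun n hn => by
    rw [hilbertFunction_vanishingIdeal hA, ncard_isReduced_all _ hn]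

theorem IsReduced.mono {d : Fin s → ℕ} {e e' : Fin s →₀ ℕ} (h : IsReduced d e) (hle : e' ≤ e) :
    IsReduced d e' :=
  fun i j hij hi => (hle j).trans_lt (h i j hij (hi.trans_le (hle i)))

theorem initialIdeal_sup_span [NeZero s] {A : Fin s → Finset K} (hA : IsNested A)
    (a : Fin s →₀ ℕ) :
    initialIdeal (lexOrder s) (vanishingIdeal (cartesianSet A)) ⊔ Ideal.span {monomial a (1 : K)} =
      Ideal.span ((fun e => monomial e (1 : K)) ''
        ({e | ¬ IsReduced (fun i => (A i).card) e} ∪ {a})) := by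
  rw [initialIdeal_vanishingIdeal hA, Set.image_union, Set.image_singleton, Ideal.span_union]

theorem hilbertFunction_initialIdeal_sup_span [NeZero s] {A : Fin s → Finset K} (hA : IsNested A)
    (a : Fin s →₀ ℕ) (n : ℕ) :
    hilbertFunction (initialIdeal (lexOrder s) (vanishingIdeal (cartesianSet A)) ⊔
        Ideal.span {monomial a (1 : K)}) n =
      {e : Fin s →₀ ℕ | e.degree = n ∧ IsReduced (fun i => (A i).card) e ∧ ¬ a ≤ e}.ncard := by
  rw [initialIdeal_sup_span hA, hilbertFunction_span_monomial]
  congr 1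
  ext e
  refine and_congr_right fun _ => ⟨fun h => ⟨?_, h a (Or.inr rfl)⟩, ?_⟩
  · by_contra he
    exact h e (Or.inl he) le_rfl
  · rintro ⟨h1, h2⟩ m (hm | rfl) hle
    exacts [hm (h1.mono hle), h2 hle]

theorem ncard_isReduced_not_le (d : Fin s → ℕ) (a : Fin s →₀ ℕ) (r : Fin s)
    (hlow : ∀ i < r, a i = 0) (har : 0 < a r) {n : ℕ} (hn : ∑ j, d j + ∑ j, a j < n) :
    {e : Fin s →₀ ℕ | e.degree = n ∧ IsReduced d e ∧ ¬ a ≤ e}.ncard +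
      ∑ i ∈ Finset.Iic r, ∏ j ∈ Finset.Ioi i, (d j - a j) = ∑ i, ∏ j ∈ Finset.Ioi i, d j := by
  rw [← ncard_isReduced d a r hlow har hn, ← ncard_isReduced_all d (n := n) (by omega)]
  have hfin := Finsupp.finite_of_degree_eq (σ := Fin s) n
  rw [← Set.ncard_union_eq _ (hfin.subset fun e he => he.1) (hfin.subset fun e he => he.1)]
  · congr 1
    ext e
    simp only [Set.mem_union, Set.mem_ofPred_eq]
    tauto
  · rw [Set.disjoint_left]
    exact fun e he he' => he.2.2 he'.2.2

theorem ringKrullDim_initialIdeal_sup_span (hs : 2 ≤ s) [NeZero s] {A : Fin s → Finset K}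
    (hA : IsNested A) {a : Fin s →₀ ℕ} {r : Fin s} (har : 0 < a r) :
    ringKrullDim (MvPolynomial (Fin s) K ⧸
      (initialIdeal (lexOrder s) (vanishingIdeal (cartesianSet A)) ⊔
        Ideal.span {monomial a (1 : K)})) = 1 := by
  rw [initialIdeal_sup_span hA]
  refine le_antisymm (ringKrullDim_quotient_le_one fun P hP hle =>
    exists_forall_sub_mem_of_isPrime fun i j hij => ?_) ?_
  · have : monomial (relationExponent (fun i => (A i).card) i j) (1 : K) ∈ P := by
      refine hle (Ideal.subset_span ⟨_, Or.inl ?_, rfl⟩)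
      rw [Set.mem_ofPred_eq, isReduced_iff]
      push Not
      exact ⟨i, j, hij, le_rfl⟩
    rw [relationExponent, ← mul_one (1 : K), ← monomial_mul] at this
    rcases hP.mem_or_mem this with h | h
    · exact Or.inl h
    · refine Or.inr ⟨0, ?_⟩
      rw [← one_pow (M := K) (A j).card, ← monomial_pow] at h
      rw [C_0, zero_mul, sub_zero]
      exact hP.mem_of_pow_mem _ h
  -- The quotient surjects onto the coordinate ring of the `k`-th axis, `k ≠ r`: `t^a` contains
  -- `t_r`, and a non-reduced monomial contains two different variables because `d_j > 0`.
  · have : Nontrivial (Fin s) := Fin.nontrivial_iff_two_le.2 hs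
    obtain ⟨k, hk⟩ := exists_ne r
    have hmono : ∀ (e : Fin s →₀ ℕ) (j : Fin s), j ≠ k → 0 < e j →
        monomial e (1 : K) ∈ RingHom.ker (lineMap (Pi.single k (1 : K))) := fun e j hj he => by
      refine mem_ker_lineMap_of_isHomogeneous (isHomogeneous_monomial (1 : K) rfl) ?_
      rw [eval_monomial, Finsupp.prod_fintype _ _ (by simp),
        Finset.prod_eq_zero (Finset.mem_univ j), mul_zero]
      rw [Pi.single_eq_of_ne hj, zero_pow he.ne']
    refine one_le_ringKrullDim_quotient (v := Pi.single k 1) (by simp) (Ideal.span_le.2 ?_)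
    rintro _ ⟨e, he | rfl, rfl⟩
    · simp only [IsReduced, Set.mem_ofPred_eq] at he
      push Not at he
      obtain ⟨i, j, hij, hi, hj⟩ := he
      by_cases hik : i = k
      · exact hmono e j (hik ▸ hij.ne')
          ((Finset.card_pos.2 ⟨0, hA.zero_mem j⟩).trans_le hj)
      · exact hmono e i hik hi
    · exact hmono e r hk.symm har

/-! ### Counting projective zeros -/

theorem exists_linearForm {p q : Projectivization K (Fin s → K)} (hpq : p ≠ q) :
    ∃ l : MvPolynomial (Fin s) K, l.IsHomogeneous 1 ∧ eval p.rep l ≠ 0 ∧ eval q.rep l = 0 := by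
  by_contra! h
  refine hpq ?_
  obtain ⟨j, hj⟩ := Function.ne_iff.1 q.rep_nonzero
  rw [← p.mk_rep, ← q.mk_rep, Projectivization.mk_eq_mk_iff']
  refine ⟨p.rep j / q.rep j, ?_⟩
  ext i
  by_contra hi
  refine h (C (q.rep j) * X i - C (q.rep i) * X j)
    ((isHomogeneous_C_mul_X _ _).sub (isHomogeneous_C_mul_X _ _)) (fun h0 => hi ?_) ?_
  · simp only [map_sub, map_mul, eval_C, eval_X] at h0
    simp only [Pi.smul_apply, smul_eq_mul]
    rw [div_mul_eq_mul_div, div_eq_iff hj]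
    linear_combination -h0
  · simp; ring

theorem exists_isHomogeneous_eval_eq (V : Finset (Projectivization K (Fin s → K))) {n : ℕ}
    (hn : V.card ≤ n) (y : Projectivization K (Fin s → K) → K) :
    ∃ g : MvPolynomial (Fin s) K, g.IsHomogeneous n ∧ ∀ p ∈ V, eval p.rep g = y p := by
  classical
  have hsep : ∀ p : Projectivization K (Fin s → K), ∃ g : MvPolynomial (Fin s) K,
      p ∈ V → g.IsHomogeneous n ∧ eval p.rep g ≠ 0 ∧ ∀ q ∈ V, q ≠ p → eval q.rep g = 0 := by
    intro p
    by_cases hp : p ∈ V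
    swap
    · exact ⟨0, fun h => absurd h hp⟩
    have hl : ∀ q : Projectivization K (Fin s → K), ∃ l : MvPolynomial (Fin s) K, p ≠ q →
        l.IsHomogeneous 1 ∧ eval p.rep l ≠ 0 ∧ eval q.rep l = 0 := fun q => by
      by_cases h : p = q
      · exact ⟨0, fun h' => absurd h h'⟩
      · obtain ⟨l, hl⟩ := exists_linearForm h
        exact ⟨l, fun _ => hl⟩
    choose l hl using hl
    obtain ⟨i, hi⟩ := Function.ne_iff.1 p.rep_nonzero
    -- A linear form through each other point, padded to degree `n` by a variable that is nonzero at
    -- `p`.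
    refine ⟨(∏ q ∈ V.erase p, l q) * X i ^ (n - (V.erase p).card), fun _ => ⟨?_, ?_, ?_⟩⟩
    · have := (IsHomogeneous.prod (V.erase p) l (fun _ => 1) fun q hq =>
        (hl q (Finset.ne_of_mem_erase hq).symm).1).mul
        (isHomogeneous_X_pow (R := K) i (n - (V.erase p).card))
      convert this using 1
      have := Finset.card_le_card (Finset.erase_subset p V)
      simp
      omega
    · rw [map_mul, map_prod, map_pow, eval_X]
      exact mul_ne_zero (Finset.prod_ne_zero_iff.2 fun q hq =>
        (hl q (Finset.ne_of_mem_erase hq).symm).2.1) (pow_ne_zero _ hi)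
    · intro q hq hqp
      rw [map_mul, map_prod, Finset.prod_eq_zero (Finset.mem_erase.2 ⟨hqp, hq⟩)
        (hl q hqp.symm).2.2, zero_mul]
  choose g hg using hsep
  refine ⟨∑ p ∈ V, C (y p / eval p.rep (g p)) * g p, ?_, fun p hp => ?_⟩
  · exact IsHomogeneous.sum _ _ _ fun p hp => (hg p hp).1.C_mul _
  · rw [map_sum, Finset.sum_eq_single p]
    · rw [map_mul, eval_C, div_mul_cancel₀ _ (hg p hp).2.1]
    · intro q hq hqp
      rw [map_mul, (hg q hq).2.2 p hp hqp.symm, mul_zero]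
    · exact fun h => absurd hp h

/-- The footprint bound: finitely many projective points on which the homogeneous polynomials in
`B` vanish are at most as many as the monomials of large degree divisible by no initial monomial
of an element of `B`. -/
theorem card_le_ncard_footprint (m : MonomialOrder (Fin s))
    (V : Finset (Projectivization K (Fin s → K))) {B : Set (MvPolynomial (Fin s) K)}
    (hB : ∀ b ∈ B, b ≠ 0 ∧ ∀ p ∈ V, b ∈ RingHom.ker (lineMap p.rep)) {n : ℕ} (hn : V.card ≤ n) :
    V.card ≤ {e : Fin s →₀ ℕ | e.degree = n ∧ ∀ b ∈ B, ¬ m.degree b ≤ e}.ncard := by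
  set T := {e : Fin s →₀ ℕ | e.degree = n ∧ ∀ b ∈ B, ¬ m.degree b ≤ e}
  have hTfin : T.Finite := (Finsupp.finite_of_degree_eq n).subset fun e he => he.1
  have := hTfin.to_subtype
  have : Module.Finite K (restrictSupport K T) := Module.Finite.of_basis (basisRestrictSupport K T)
  let φ : restrictSupport K T →ₗ[K] (V → K) :=
    LinearMap.pi fun p => (aeval p.1.rep).toLinearMap ∘ₗ (restrictSupport K T).subtype
  -- Interpolate by a form of degree `n`, divide by `B`, and keep the degree `n` component of the
  -- remainder: the values on `V` are unchanged.
  have hφ : Function.Surjective φ := by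
    classical
    intro y
    obtain ⟨g, hg, hgy⟩ := exists_isHomogeneous_eval_eq V hn
      fun p => if h : p ∈ V then y ⟨p, h⟩ else 0
    obtain ⟨r, hgr, hr⟩ := exists_remainder m (B := B)
      (J := ⨅ p ∈ V, RingHom.ker (lineMap p.rep))
      (fun b hb => by simpa [Submodule.mem_iInf] using (hB b hb).2)
      (fun b hb => isUnit_iff_ne_zero.2 (m.leadingCoeff_ne_zero_iff.2 (hB b hb).1)) g
    refine ⟨⟨homogeneousComponent n r, (mem_restrictSupport_iff K).2 fun e he => ?_⟩, ?_⟩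
    · rw [Finset.mem_coe, support_homogeneousComponent, Finset.mem_filter] at he
      exact ⟨he.2, hr e he.1⟩
    · ext ⟨p, hp⟩
      have h1 : g - r ∈ RingHom.ker (lineMap p.rep) := by
        simp only [Submodule.mem_iInf] at hgr
        exact hgr p hp
      have h2 := (mem_ker_lineMap_iff _ _).1 h1 n
      rw [map_sub, map_sub, homogeneousComponent_eq_self hg, hgy p hp, dif_pos hp,
        sub_eq_zero] at h2
      exact h2.symm
  have := LinearMap.finrank_le_finrank_of_surjective hφ
  rwa [finrank_restrictSupport, Module.finrank_fintype_fun_eq_card, Fintype.card_coe] at this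

theorem ncard_zeroSet_le [Finite K] {A : Fin s → Finset K} (hA : IsNested A)
    {f : MvPolynomial (Fin s) K} (hf : f ≠ 0) {k : ℕ} (hhom : f.IsHomogeneous k) {n : ℕ}
    (hn : (zeroSet (cartesianSet A) f).ncard ≤ n) :
    (zeroSet (cartesianSet A) f).ncard ≤
      {e : Fin s →₀ ℕ | e.degree = n ∧ IsReduced (fun i => (A i).card) e ∧
        ¬ (lexOrder s).degree f ≤ e}.ncard := by
  have : Finite (Projectivization K (Fin s → K)) := Quotient.finite _
  have hfin : (zeroSet (cartesianSet A) f).Finite := Set.toFinite _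
  rw [Set.ncard_eq_toFinset_card _ hfin] at hn ⊢
  refine (card_le_ncard_footprint (lexOrder s) hfin.toFinset
    (B := insert f (groebnerBasis A)) ?_ hn).trans (Set.ncard_le_ncard ?_ ?_)
  · rintro b (rfl | hb)
    · refine ⟨hf, fun p hp => mem_ker_lineMap_of_isHomogeneous hhom ?_⟩
      exact (hfin.mem_toFinset.1 hp).2 p.rep p.rep_nonzero p.mk_rep
    · refine ⟨?_, fun p hp => vanishingIdeal_le_ker_lineMap p.rep_nonzero ?_
        (groebnerBasis_subset hA hb)⟩
      · rintro rfl
        simpa using isUnit_leadingCoeff_of_mem_groebnerBasis hb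
      · rw [p.mk_rep]
        exact (hfin.mem_toFinset.1 hp).1
  · rintro e ⟨h1, h2⟩
    exact ⟨h1, isReduced_of_forall_groebnerBasis fun b hb => h2 b (Or.inr hb), h2 f (Or.inl rfl)⟩
  · exact (Finsupp.finite_of_degree_eq n).subset fun e he => he.1

end NestedCartesian

end

/- Indices run over `Fin s`. In the first formula, the term of the sum at `i` is the product of
`d_j - a_j` over all `j > i`, and `i` runs up to `r`: with variables numbered from `1` this is
the sum over `2 ≤ i ≤ r + 1` of the products over `j ≥ i`. Empty products are `1`. -/
theorem theorem5p4 {K : Type*} [Field K] [Finite K] {s : ℕ} (hs : 2 ≤ s)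
    (A : Fin s → Finset K) (hA : NestedCartesian.IsNested A)
    (f : MvPolynomial (Fin s) K)
    (hf : NestedCartesian.IsStandardPolynomial (NestedCartesian.lexOrder s)
      (NestedCartesian.vanishingIdeal (NestedCartesian.cartesianSet A)) f)
    (a : Fin s →₀ ℕ) (ha : (NestedCartesian.lexOrder s).degree f = a)
    (r : Fin s) (hlow : ∀ i, i < r → a i = 0) (har : 1 ≤ a r) :
    (∀ i, r < i → (a i : ℤ) ≤ ((A i).card : ℤ) - 1) ∧
    ∃ D E : ℕ,
      NestedCartesian.HasDegree
        (NestedCartesian.vanishingIdeal (NestedCartesian.cartesianSet A)) D ∧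
      NestedCartesian.HasDegree
        (NestedCartesian.initialIdeal (NestedCartesian.lexOrder s)
            (NestedCartesian.vanishingIdeal (NestedCartesian.cartesianSet A)) ⊔
          Ideal.span {MvPolynomial.monomial a (1 : K)}) E ∧
      ((∃ n, f.IsHomogeneous n) →
        (NestedCartesian.zeroSet (NestedCartesian.cartesianSet A) f).ncard ≤ E) ∧
      (a r ≤ (A r).card →
        (E : ℤ) = (D : ℤ) -
          ∑ i ∈ Finset.Iic r, ∏ j ∈ Finset.Ioi i, (((A j).card : ℤ) - (a j : ℤ))) ∧
      ((A r).card + 1 ≤ a r →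
        (E : ℤ) = (D : ℤ) -
          ∏ j ∈ Finset.Ioi r, (((A j).card : ℤ) - (a j : ℤ))) := by
  classical
  have : NeZero s := ⟨by omega⟩
  set d : Fin s → ℕ := fun i => (A i).card with hd
  have hred : NestedCartesian.IsReduced d a :=
    (NestedCartesian.isReduced_iff_isStandardMonomial hA).1
      (hf.2 a (ha ▸ MonomialOrder.degree_mem_support hf.1))
  have hlt : ∀ i, r < i → a i < d i := fun i hi => hred r i hi har
  refine ⟨fun i hi => by have := hlt i hi; simp only [hd] at this; omega, ?_⟩
  set P : ℕ := ∑ i ∈ Finset.Iic r, ∏ j ∈ Finset.Ioi i, (d j - a j) with hP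
  have hcount := fun n (hn : ∑ j, d j + ∑ j, a j < n) =>
    NestedCartesian.ncard_isReduced_not_le d a r hlow har hn
  have hPD : P ≤ ∑ i, ∏ j ∈ Finset.Ioi i, d j := by
    rw [← hcount _ (Nat.lt_succ_self _)]
    exact Nat.le_add_left _ _
  set D : ℕ := ∑ i, ∏ j ∈ Finset.Ioi i, d j
  refine ⟨D, D - P,
    NestedCartesian.hasDegree_vanishingIdeal hA, ?_, ?_, fun h => ?_, fun h => ?_⟩
  · refine NestedCartesian.hasDegree_of_eventually
      (NestedCartesian.ringKrullDim_initialIdeal_sup_span hs hA har)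
      (N := ∑ j, d j + ∑ j, a j) fun n hn => ?_
    rw [NestedCartesian.hilbertFunction_initialIdeal_sup_span hA, ← hcount n hn,
      Nat.add_sub_cancel]
  · rintro ⟨k, hk⟩
    -- The degree chosen next exceeds both the counting threshold and the number of zeros.
    set N := (NestedCartesian.zeroSet (NestedCartesian.cartesianSet A) f).ncard
    rw [← hcount (∑ j, d j + ∑ j, a j + 1 + N) (by omega), Nat.add_sub_cancel, ← ha]
    exact NestedCartesian.ncard_zeroSet_le hA hf.1 hk (by omega)
  · rw [Nat.cast_sub hPD, hP]
    -- Here `a_j ≤ d_j` for every `j`, so no subtraction is truncated.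
    refine congrArg _ ((Nat.cast_sum _ _).trans (Finset.sum_congr rfl fun i _ => ?_))
    rw [Nat.cast_prod]
    refine Finset.prod_congr rfl fun j _ => Nat.cast_sub ?_
    rcases lt_trichotomy j r with hj | rfl | hj
    · rw [hlow j hj]; exact Nat.zero_le _
    · exact h
    · exact (hlt j hj).le
  · rw [Nat.cast_sub hPD, hP, Finset.sum_eq_single_of_mem r (Finset.mem_Iic.2 le_rfl)]
    · exact congrArg _ ((Nat.cast_prod _ _).trans (Finset.prod_congr rfl fun j hj =>
        Nat.cast_sub (hlt j (Finset.mem_Ioi.1 hj)).le))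
    -- For `i < r` the product contains the truncated factor `d_r - a_r = 0`.
    · intro i hi hir
      refine Finset.prod_eq_zero
        (Finset.mem_Ioi.2 (lt_of_le_of_ne (Finset.mem_Iic.1 hi) hir)) ?_
      exact Nat.sub_eq_zero_of_le (Nat.le_of_succ_le h)
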